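/- Let $E=E_\rho\oplus iE_\rho$ be a universally complete Archimedean complex vector lattice; that is, the real part $E_\rho$ is a Dedekind complete vector lattice in which every nonempty set of pairwise disjoint positive elements has a supremum, and $|f+ig|=\sup\{(\cos\theta)f+(\sin\theta)g:\theta\in[0,2\pi]\}\in E_\rho$ for $f,g\in E_\rho$. Let $E_\rho$ carry its $\Phi$-algebra multiplication ($f$-algebra multiplication with a unit $e$), extended to $E$ in the canonical way, with $z^0=e$. A sequence $(x_n)_{n\ge0}$ in $E$ converges in order to $x$, written $x_n\to x$, if there is a decreasing sequence $(p_n)$ in $E_\rho$ with $\inf_n p_n=0$ and $|x_n-x|\le p_n$ for all $n\ge 0$. A series converges in order, with sum $s$, if its partial sums converge in order to $s$. For $x,y\in E_\rho$ write $x\ll y$ if $(y-x)^+$ is a weak order unit, where $u\ge0$ is a weak order unit if $|x|\wedge u=0$ implies $x=0$. Let $S(z)=\sum_{n=0}^\infty a_nz^n$ be a power series with $a_n\in E$, and let $\Omega_S$ be the set of all $r\ge0$ in $E_\rho$ for which $S$ converges uniformly in order on $\{z\in E:|z|\le r\}$, i.e. for which there are a function $S(z)$ on this set and a decreasing sequence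 $(p_m)$ in $E_\rho$ with $\inf_m p_m=0$ such that $\left|\sum_{n=0}^m a_nz^n-S(z)\right|\le p_m$ for all $m\ge0$ and all $z$ with $|z|\le r$. Suppose that $\Omega_S$ is order bounded, that the radius of convergence $\rho_S=\sup\Omega_S$ is a weak order unit, and that the series $S(\rho_S)$ converges in order. Let $(z_k)_{k\ge0}$ be a sequence in $E$ such that (i) $z_k\to\rho_S$, (ii) $|z_k|\ll\rho_S$ for each $k\ge0$, and (iii) the set $\{|\rho_S-z_k|(\rho_S-|z_k|)^{-1}:k\ge0\}$ is order bounded. Then the series $S(z_k)$ converges in order for each $k$, and $S(z_k)\to S(\rho_S)$. -/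

import Mathlib

namespace VLSeries

/-- A real `f`-algebra: a vector lattice with an associative bilinear multiplication for which the
product of positive elements is positive and multiplication by a positive element (on either side)
preserves disjointness.  The unit of the ring makes it a `Φ`-algebra; commutativity is not part of
the definition. -/
class IsFAlgebra (A : Type*) [Ring A] [Lattice A] [Algebra ℝ A] : Prop
    extends IsOrderedAddMonoid A, IsOrderedModule ℝ A where
  mul_nonneg : ∀ x y : A, 0 ≤ x → 0 ≤ y → 0 ≤ x * y
  mul_right_inf_eq_zero : ∀ x y z : A, x ⊓ y = 0 → 0 ≤ z → (x * z) ⊓ y = 0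
  mul_left_inf_eq_zero : ∀ x y z : A, x ⊓ y = 0 → 0 ≤ z → (z * x) ⊓ y = 0

/-- Lateral completeness: every nonempty set of pairwise disjoint positive elements has a supremum.
A `ConditionallyCompleteLattice` (Dedekind complete, hence Archimedean) vector lattice with this
property is a universally complete vector lattice. -/
class IsLaterallyComplete (A : Type*) [Lattice A] [Zero A] : Prop where
  exists_isLUB : ∀ s : Set A, s.Nonempty → (∀ x ∈ s, 0 ≤ x) →
    (∀ x ∈ s, ∀ y ∈ s, x ≠ y → x ⊓ y = 0) → ∃ u : A, IsLUB s u

/-- `u` is a weak order unit: it is positive and only `0` is disjoint from it. -/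
def IsWeakOrderUnit {A : Type*} [Lattice A] [AddGroup A] (u : A) : Prop :=
  0 ≤ u ∧ ∀ x : A, |x| ⊓ u = 0 → x = 0

/-- `x ≪ y`: the positive part of `y - x` is a weak order unit. -/
def MuchLess {A : Type*} [Lattice A] [AddGroup A] (x y : A) : Prop :=
  IsWeakOrderUnit ((y - x) ⊔ 0)

/-- `p n ↓ 0`: the sequence is decreasing with infimum `0`. -/
def DecreasesToZero {A : Type*} [Lattice A] [Zero A] (p : ℕ → A) : Prop :=
  Antitone p ∧ IsGLB (Set.range p) 0

/-- A set is order bounded: it is contained in an order interval. -/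
def IsOrderBounded {A : Type*} [Preorder A] (s : Set A) : Prop :=
  ∃ u v : A, s ⊆ Set.Icc u v

/-- The complexification `A ⊕ iA`; `⟨f, g⟩` stands for `f + i g`. -/
@[ext] structure Cplx (A : Type*) where
  re : A
  im : A

namespace Cplx

variable {A : Type*}

section Ring

variable [Ring A]

instance : Zero (Cplx A) := ⟨⟨0, 0⟩⟩
instance : One (Cplx A) := ⟨⟨1, 0⟩⟩
instance : Add (Cplx A) := ⟨fun z w => ⟨z.re + w.re, z.im + w.im⟩⟩
instance : Neg (Cplx A) := ⟨fun z => ⟨-z.re, -z.im⟩⟩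
instance : Sub (Cplx A) := ⟨fun z w => ⟨z.re - w.re, z.im - w.im⟩⟩
instance : Mul (Cplx A) :=
  ⟨fun z w => ⟨z.re * w.re - z.im * w.im, z.re * w.im + z.im * w.re⟩⟩

@[simp] theorem zero_re : (0 : Cplx A).re = 0 := rfl
@[simp] theorem zero_im : (0 : Cplx A).im = 0 := rfl
@[simp] theorem one_re : (1 : Cplx A).re = 1 := rfl
@[simp] theorem one_im : (1 : Cplx A).im = 0 := rfl
@[simp] theorem add_re (z w : Cplx A) : (z + w).re = z.re + w.re := rfl
@[simp] theorem add_im (z w : Cplx A) : (z + w).im = z.im + w.im := rfl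
@[simp] theorem neg_re (z : Cplx A) : (-z).re = -z.re := rfl
@[simp] theorem neg_im (z : Cplx A) : (-z).im = -z.im := rfl
@[simp] theorem sub_re (z w : Cplx A) : (z - w).re = z.re - w.re := rfl
@[simp] theorem sub_im (z w : Cplx A) : (z - w).im = z.im - w.im := rfl
@[simp] theorem mul_re (z w : Cplx A) : (z * w).re = z.re * w.re - z.im * w.im := rfl
@[simp] theorem mul_im (z w : Cplx A) : (z * w).im = z.re * w.im + z.im * w.re := rfl

instance : Ring (Cplx A) where
  add_assoc _ _ _ := by ext <;> simp [add_assoc]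
  zero_add _ := by ext <;> simp
  add_zero _ := by ext <;> simp
  add_comm _ _ := by ext <;> simp [add_comm]
  neg_add_cancel _ := by ext <;> simp
  sub_eq_add_neg _ _ := by ext <;> simp [sub_eq_add_neg]
  nsmul := nsmulRec
  zsmul := zsmulRec
  mul_assoc _ _ _ := by ext <;> simp <;> noncomm_ring
  one_mul _ := by ext <;> simp
  mul_one _ := by ext <;> simp
  zero_mul _ := by ext <;> simp
  mul_zero _ := by ext <;> simp
  left_distrib _ _ _ := by ext <;> simp <;> noncomm_ring
  right_distrib _ _ _ := by ext <;> simp <;> noncomm_ring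

/-- The inclusion of the real part `A` in `A ⊕ iA`. -/
def ofReal (x : A) : Cplx A := ⟨x, 0⟩

end Ring

/-- The modulus `|f + i g| = sup {(cos θ) f + (sin θ) g : θ ∈ [0, 2π]}`, with values in the
real part. -/
noncomputable def modulus [ConditionallyCompleteLattice A] [Ring A] [Algebra ℝ A]
    (z : Cplx A) : A :=
  sSup ((fun θ : ℝ => Real.cos θ • z.re + Real.sin θ • z.im) '' Set.Icc 0 (2 * Real.pi))

end Cplx

section Series

variable {A : Type*} [ConditionallyCompleteLattice A] [Ring A] [Algebra ℝ A]

/-- The sequence `x` converges in order to `l`. -/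
def OrderTendsto (x : ℕ → Cplx A) (l : Cplx A) : Prop :=
  ∃ p : ℕ → A, DecreasesToZero p ∧ ∀ n, (x n - l).modulus ≤ p n

/-- The partial sum `∑_{n=0}^m a_n z^n`. -/
def partialSum (a : ℕ → Cplx A) (z : Cplx A) (m : ℕ) : Cplx A :=
  ∑ n ∈ Finset.range (m + 1), a n * z ^ n

/-- The power series `∑ a_n z^n` converges in order at the point `z`, with sum `s`. -/
def HasOrderSum (a : ℕ → Cplx A) (z s : Cplx A) : Prop :=
  OrderTendsto (partialSum a z) s

/-- The power series `∑ a_n z^n` converges uniformly in order on `D`. -/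
def ConvergesUniformlyInOrderOn (a : ℕ → Cplx A) (D : Set (Cplx A)) : Prop :=
  ∃ (S : Cplx A → Cplx A) (p : ℕ → A), DecreasesToZero p ∧
    ∀ m, ∀ z ∈ D, (partialSum a z m - S z).modulus ≤ p m

/-- The order closed ball with centre `c` and radius `r`. -/
def orderClosedBall (c : Cplx A) (r : A) : Set (Cplx A) :=
  {z | (z - c).modulus ≤ r}

/-- The set `Ω_S` of all `r ≥ 0` such that `∑ a_n z^n` converges uniformly in order on the order
closed ball with centre `0` and radius `r`. -/
def convergenceRadii (a : ℕ → Cplx A) : Set A :=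
  {r | 0 ≤ r ∧ ConvergesUniformlyInOrderOn a (orderClosedBall 0 r)}

/-- The set `Ω_S` is order bounded and `ρ = sup Ω_S` is the radius of convergence. -/
def HasRadiusOfConvergence (a : ℕ → Cplx A) (ρ : A) : Prop :=
  IsOrderBounded (convergenceRadii a) ∧ IsLUB (convergenceRadii a) ρ

end Series

end VLSeries

open VLSeries

/-!
Write `S_n(z)` for the partial sums and `D n = S_n(ρ) - s`, with `|D n| ≤ p n`. Multiplied by
`ρ ^ M` to avoid the quotient `z / ρ`, Abel's summation by parts expresses `(S_M(z) - S_N(z)) ρ ^ M`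
through the `D n` with `N ≤ n ≤ M`. On the Stolz region `|ρ - z| ≤ K (ρ - |z|)` the geometric sum
that appears telescopes, which gives the bound `(2 + K) p N ρ ^ M`, and powers of the weak order
unit `ρ` can be cancelled. So the series converges uniformly on the Stolz region, which contains
`ρ`, and a uniform limit of polynomials is order continuous there.

Three facts about `Φ`-algebras make this work. An Archimedean one is commutative: the commutators of
`y` with `x⁺` and `x⁻` are disjoint, hence `|[y, x]| ≤ |[y, |x|]|`, and shifting `|x|` by a multiple
of `1` halves a bound on `x` without changing the commutator. The modulus is submultiplicative:
`f² + g²` is multiplicative, and `f² + g² ≤ |f + ig|²` follows by improving the crude bound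
`f² + g² ≤ 2 |f + ig|²` repeatedly through angle doubling. In the laterally complete case weak order
units are invertible, since the inverse can be assembled from the pairwise disjoint components on
which `n u ≤ 1 < (n + 1) u`.
-/

namespace VLSeries

section LatticeOrderedGroup

variable {A : Type*} [Lattice A] [AddCommGroup A] [IsOrderedAddMonoid A]

theorem inf_eq_zero_of_le_of_le {A : Type*} [Lattice A] [Zero A] {a b c d : A} (ha : 0 ≤ a)
    (hb : 0 ≤ b) (hac : a ≤ c) (hbd : b ≤ d) (h : c ⊓ d = 0) : a ⊓ b = 0 :=
  le_antisymm (h ▸ inf_le_inf hac hbd) (le_inf ha hb)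

theorem inf_add_eq_zero {a b c : A} (hb : a ⊓ b = 0) (hc : a ⊓ c = 0) : a ⊓ (b + c) = 0 := by
  have ha₀ : 0 ≤ a := hb ▸ inf_le_left
  have hb₀ : 0 ≤ b := hb ▸ inf_le_right
  have hc₀ : 0 ≤ c := hc ▸ inf_le_right
  refine le_antisymm ?_ (le_inf ha₀ (add_nonneg hb₀ hc₀))
  calc a ⊓ (b + c) ≤ a ⊓ b + a ⊓ c := by
        rw [add_inf, inf_add, inf_add]
        exact le_inf
          (le_inf (inf_le_of_left_le (le_add_of_nonneg_left ha₀))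
            (inf_le_of_left_le (le_add_of_nonneg_left hb₀)))
          (le_inf (inf_le_of_left_le (le_add_of_nonneg_right hc₀)) inf_le_right)
    _ = 0 := by rw [hb, hc, add_zero]

theorem eq_zero_of_abs_nonpos {a : A} (h : |a| ≤ 0) : a = 0 :=
  le_antisymm ((le_abs_self a).trans h) (neg_nonpos.1 ((neg_le_abs a).trans h))

theorem abs_sub_le_abs_add_of_inf_abs_eq_zero {a b : A} (h : |a| ⊓ |b| = 0) :
    |a - b| ≤ |a + b| :=
  calc |a - b| ≤ |a| + |b| := by simpa [sub_eq_add_neg] using abs_add_le a (-b)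
    _ = |a| ⊔ |b| := by rw [← inf_add_sup, h, zero_add]
    _ = |(|b| - |a|)| := by rw [← sup_sub_inf_eq_abs_sub, h, sub_zero]
    _ = |(|a| - |-b|)| := by rw [abs_neg, abs_sub_comm]
    _ ≤ |a + b| := by simpa using abs_abs_sub_abs_le a (-b)

theorem MuchLess.le {x y : A} (h : MuchLess x y) : x ≤ y := by
  have hzero : (y - x)⁻ = 0 := h.2 _ <| by
    rw [abs_of_nonneg (negPart_nonneg _), inf_comm]
    exact posPart_inf_negPart_eq_zero (y - x)
  exact sub_nonneg.1 (negPart_eq_zero.1 hzero)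

theorem MuchLess.isWeakOrderUnit_sub {x y : A} (h : MuchLess x y) : IsWeakOrderUnit (y - x) := by
  have hsup : (y - x) ⊔ 0 = y - x := sup_of_le_left (sub_nonneg.2 h.le)
  rwa [MuchLess, hsup] at h

end LatticeOrderedGroup

section Archimedean

variable {A : Type*} [ConditionallyCompleteLattice A] [AddCommGroup A] [IsOrderedAddMonoid A]

theorem nonpos_of_forall_nsmul_le {x y : A} (h : ∀ n : ℕ, n • x ≤ y) : x ≤ 0 := by
  have hbdd : BddAbove (Set.range fun n : ℕ => n • x) := ⟨y, Set.forall_mem_range.2 h⟩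
  have hshift : ⨆ n : ℕ, n • x ≤ (⨆ n : ℕ, n • x) - x := by
    refine ciSup_le fun n => le_sub_iff_add_le.2 ?_
    rw [← succ_nsmul]
    exact le_ciSup hbdd (n + 1)
  simpa using hshift

theorem nonpos_of_forall_le_inv_smul [Module ℝ A] [IsOrderedModule ℝ A] {x y : A}
    (h : ∀ n : ℕ, 0 < n → x ≤ (n : ℝ)⁻¹ • y) : x ≤ 0 := by
  refine nonpos_of_forall_nsmul_le (y := y⁺) fun n => ?_
  rcases n.eq_zero_or_pos with rfl | hn
  · simp
  · rw [← Nat.cast_smul_eq_nsmul ℝ]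
    exact ((le_inv_smul_iff_of_pos (Nat.cast_pos.2 hn)).1 (h n hn)).trans (le_posPart y)

end Archimedean

section FAlgebra

variable {A : Type*} [Lattice A] [Ring A] [Algebra ℝ A] [IsFAlgebra A]

theorem mul_eq_zero_of_inf_eq_zero {x y : A} (h : x ⊓ y = 0) : x * y = 0 := by
  have hx : 0 ≤ x := h ▸ inf_le_left
  have hy : 0 ≤ y := h ▸ inf_le_right
  have hxy : y ⊓ (x * y) = 0 := by
    rw [inf_comm]
    exact IsFAlgebra.mul_right_inf_eq_zero x y y h hy
  simpa using IsFAlgebra.mul_left_inf_eq_zero y (x * y) x hxy hx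

theorem IsFAlgebra.mul_self_nonneg (x : A) : 0 ≤ x * x := by
  have hpn : x⁺ * x⁻ = 0 := mul_eq_zero_of_inf_eq_zero (posPart_inf_negPart_eq_zero x)
  have hnp : x⁻ * x⁺ = 0 :=
    mul_eq_zero_of_inf_eq_zero ((inf_comm _ _).trans (posPart_inf_negPart_eq_zero x))
  calc 0 ≤ x⁺ * x⁺ + x⁻ * x⁻ :=
        add_nonneg (IsFAlgebra.mul_nonneg _ _ (posPart_nonneg x) (posPart_nonneg x))
          (IsFAlgebra.mul_nonneg _ _ (negPart_nonneg x) (negPart_nonneg x))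
    _ = (x⁺ - x⁻) * (x⁺ - x⁻) := by rw [sub_mul, mul_sub, mul_sub, hpn, hnp]; abel
    _ = x * x := by rw [posPart_sub_negPart]

instance IsFAlgebra.toIsOrderedRing : IsOrderedRing A :=
  haveI : ZeroLEOneClass A := ⟨by simpa using IsFAlgebra.mul_self_nonneg (1 : A)⟩
  IsOrderedRing.of_mul_nonneg fun x y => IsFAlgebra.mul_nonneg x y

theorem mul_le_abs_mul_abs (x y : A) : x * y ≤ |x| * |y| := by
  have hnonneg : 0 ≤ (|x| - x) * (|y| + y) + (|x| + x) * (|y| - y) :=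
    add_nonneg
      (mul_nonneg (sub_nonneg.2 (le_abs_self x)) (neg_le_iff_add_nonneg.1 (neg_le_abs y)))
      (mul_nonneg (neg_le_iff_add_nonneg.1 (neg_le_abs x)) (sub_nonneg.2 (le_abs_self y)))
  have htwo : (|x| - x) * (|y| + y) + (|x| + x) * (|y| - y) = (2 : ℝ) • (|x| * |y| - x * y) := by
    rw [two_smul]; noncomm_ring
  rw [htwo] at hnonneg
  exact sub_nonneg.1 ((smul_nonneg_iff_nonneg_of_pos_left two_pos).1 hnonneg)

theorem abs_mul_le (x y : A) : |x * y| ≤ |x| * |y| :=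
  abs_le'.2 ⟨mul_le_abs_mul_abs x y, by simpa using mul_le_abs_mul_abs x (-y)⟩

theorem mul_self_le_mul_self_of_abs_le {x y : A} (h : |x| ≤ y) : x * x ≤ y * y :=
  (mul_le_abs_mul_abs x x).trans (mul_le_mul h h (abs_nonneg x) ((abs_nonneg x).trans h))

end FAlgebra

section Commutativity

attribute [local instance] LieRing.ofAssociativeRing

variable {A : Type*}

section Lattice

variable [Lattice A] [Ring A] [Algebra ℝ A] [IsFAlgebra A]

theorem abs_lie_le (y x : A) : |⁅y, x⁆| ≤ |y| * |x| + |x| * |y| :=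
  calc |⁅y, x⁆| ≤ |y * x| + |x * y| := by
        simpa [Ring.lie_def, sub_eq_add_neg] using abs_add_le (y * x) (-(x * y))
    _ ≤ |y| * |x| + |x| * |y| := add_le_add (abs_mul_le y x) (abs_mul_le x y)

theorem inf_mul_add_mul_eq_zero {x y z : A} (h : x ⊓ y = 0) (hz : 0 ≤ z) :
    x ⊓ (z * y + y * z) = 0 := by
  rw [inf_comm] at h
  refine inf_add_eq_zero ?_ ?_ <;> rw [inf_comm]
  · exact IsFAlgebra.mul_left_inf_eq_zero y x z h hz
  · exact IsFAlgebra.mul_right_inf_eq_zero y x z h hz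

theorem abs_lie_le_abs_lie_abs (y x : A) : |⁅y, x⁆| ≤ |⁅y, |x|⁆| := by
  have hbound : (|y| * x⁺ + x⁺ * |y|) ⊓ (|y| * x⁻ + x⁻ * |y|) = 0 := by
    refine inf_mul_add_mul_eq_zero ?_ (abs_nonneg y)
    rw [inf_comm]
    exact inf_mul_add_mul_eq_zero ((inf_comm _ _).trans (posPart_inf_negPart_eq_zero x))
      (abs_nonneg y)
  have hdisj : |⁅y, x⁺⁆| ⊓ |⁅y, x⁻⁆| = 0 :=
    inf_eq_zero_of_le_of_le (abs_nonneg _) (abs_nonneg _)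
      (by simpa only [abs_of_nonneg (posPart_nonneg x)] using abs_lie_le y x⁺)
      (by simpa only [abs_of_nonneg (negPart_nonneg x)] using abs_lie_le y x⁻) hbound
  calc |⁅y, x⁆| = |⁅y, x⁺⁆ - ⁅y, x⁻⁆| := by rw [← lie_sub, posPart_sub_negPart]
    _ ≤ |⁅y, x⁺⁆ + ⁅y, x⁻⁆| := abs_sub_le_abs_add_of_inf_abs_eq_zero hdisj
    _ = |⁅y, |x|⁆| := by rw [← lie_add, posPart_add_negPart]

-- Passing from `x` to `|x| - (c / 2) • 1` halves the bound on `x` without shrinking the commutator.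
theorem abs_lie_le_of_abs_le_smul_one (n : ℕ) {y x : A} {c : ℝ} (hx : |x| ≤ c • 1) :
    |⁅y, x⁆| ≤ (2 * c / 2 ^ n) • |y| := by
  induction n generalizing c x with
  | zero =>
    calc |⁅y, x⁆| ≤ |y| * |x| + |x| * |y| := abs_lie_le y x
      _ ≤ |y| * c • 1 + c • 1 * |y| :=
        add_le_add (mul_le_mul_of_nonneg_left hx (abs_nonneg y))
          (mul_le_mul_of_nonneg_right hx (abs_nonneg y))
      _ = (2 * c / 2 ^ 0) • |y| := by
        rw [mul_smul_comm, smul_mul_assoc, mul_one, one_mul]; module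
  | succ n ih =>
    have hhalf : |(|x| - (c / 2) • (1 : A))| ≤ (c / 2) • 1 := by
      refine abs_le'.2 ⟨?_, ?_⟩
      · rwa [sub_le_iff_le_add, ← add_smul, add_halves]
      · simp
    calc |⁅y, x⁆| ≤ |⁅y, |x|⁆| := abs_lie_le_abs_lie_abs y x
      _ = |⁅y, |x| - (c / 2) • (1 : A)⁆| := by simp [Ring.lie_def, mul_sub, sub_mul]
      _ ≤ (2 * (c / 2) / 2 ^ n) • |y| := ih hhalf
      _ = (2 * c / 2 ^ (n + 1)) • |y| := by congr 1; ring

theorem posPart_sub_smul_one_le {x : A} (hx : 0 ≤ x) {l : ℝ} (hl : 0 < l) :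
    (x - l • (1 : A))⁺ ≤ l⁻¹ • (x * x) := by
  refine sup_le ?_ (smul_nonneg (inv_nonneg.2 hl.le) (mul_nonneg hx hx))
  rw [le_inv_smul_iff_of_pos hl]
  have hsq : 0 ≤ (x - l • (1 : A)) * (x - l • (1 : A)) := IsFAlgebra.mul_self_nonneg _
  have hexpand : (x - l • (1 : A)) * (x - l • (1 : A)) =
      x * x - l • (x - l • (1 : A)) - l • x := by
    simp only [mul_sub, sub_mul, mul_smul_comm, smul_mul_assoc, mul_one, one_mul, smul_sub]
    abel
  rw [hexpand, sub_nonneg, le_sub_iff_add_le'] at hsq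
  exact (le_add_of_nonneg_right (smul_nonneg hl.le hx)).trans hsq

end Lattice

variable [ConditionallyCompleteLattice A] [Ring A] [Algebra ℝ A] [IsFAlgebra A]

theorem lie_eq_zero_of_abs_le_smul_one {y x : A} {c : ℝ} (hx : |x| ≤ c • 1) : ⁅y, x⁆ = 0 := by
  have hle : |⁅y, x⁆| ≤ 0 := nonpos_of_forall_le_inv_smul (y := (2 * |c|) • |y|) fun n hn =>
    calc |⁅y, x⁆| ≤ (2 * |c| / 2 ^ n) • |y| :=
          abs_lie_le_of_abs_le_smul_one n (hx.trans (smul_le_smul_of_nonneg_right (le_abs_self c)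
            zero_le_one))
      _ ≤ (2 * |c| / n) • |y| := by
          refine smul_le_smul_of_nonneg_right ?_ (abs_nonneg y)
          gcongr
          exact_mod_cast Nat.lt_two_pow_self.le
      _ = (n : ℝ)⁻¹ • (2 * |c|) • |y| := by rw [smul_smul]; congr 1; ring
  exact eq_zero_of_abs_nonpos hle

theorem lie_eq_zero_of_nonneg {y x : A} (hx : 0 ≤ x) : ⁅y, x⁆ = 0 := by
  refine eq_zero_of_abs_nonpos (nonpos_of_forall_le_inv_smul
    (y := |y| * (x * x) + x * x * |y|) fun n hn => ?_)
  have hn' : (0 : ℝ) < n := Nat.cast_pos.2 hn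
  set t := (x - (n : ℝ) • (1 : A))⁺
  have htrunc : ⁅y, x ⊓ (n : ℝ) • 1⁆ = 0 := by
    refine lie_eq_zero_of_abs_le_smul_one (c := n) ?_
    rw [abs_of_nonneg (le_inf hx (smul_nonneg hn'.le zero_le_one))]
    exact inf_le_right
  have hsplit : x = x ⊓ (n : ℝ) • 1 + t := by
    rw [← sub_eq_iff_eq_add', sub_inf, sub_self, sup_comm]; rfl
  have ht₀ : 0 ≤ t := posPart_nonneg _
  have ht_le : t ≤ (n : ℝ)⁻¹ • (x * x) := posPart_sub_smul_one_le hx hn'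
  calc |⁅y, x⁆| = |⁅y, t⁆| := by rw [hsplit, lie_add, htrunc, zero_add]
    _ ≤ |y| * t + t * |y| := by
      simpa only [abs_of_nonneg ht₀] using abs_lie_le y t
    _ ≤ |y| * (n : ℝ)⁻¹ • (x * x) + (n : ℝ)⁻¹ • (x * x) * |y| :=
      add_le_add (mul_le_mul_of_nonneg_left ht_le (abs_nonneg y))
        (mul_le_mul_of_nonneg_right ht_le (abs_nonneg y))
    _ = _ := by rw [mul_smul_comm, smul_mul_assoc, smul_add]

protected theorem IsFAlgebra.mul_comm (x y : A) : x * y = y * x := by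
  have hlie : ⁅x, y⁆ = 0 := by
    rw [← posPart_sub_negPart y, lie_sub, lie_eq_zero_of_nonneg (posPart_nonneg y),
      lie_eq_zero_of_nonneg (negPart_nonneg y), sub_zero]
  exact sub_eq_zero.1 hlie

end Commutativity

section Semiprime

theorem posPart_mul_self {A : Type*} [Lattice A] [Ring A] [Algebra ℝ A] [IsFAlgebra A] (x : A) :
    x⁺ * x = x⁺ * x⁺ := by
  have hpn : x⁺ * x⁻ = 0 := mul_eq_zero_of_inf_eq_zero (posPart_inf_negPart_eq_zero x)
  calc x⁺ * x = x⁺ * (x⁺ - x⁻) := by rw [posPart_sub_negPart]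
    _ = x⁺ * x⁺ := by rw [mul_sub, hpn, sub_zero]

theorem mul_posPart_one_sub_le_one {A : Type*} [Lattice A] [CommRing A] [Algebra ℝ A]
    [IsFAlgebra A] {x : A} (hx : 0 ≤ x) : x * (1 - x)⁺ ≤ 1 :=
  calc x * (1 - x)⁺ = (1 - x)⁺ - (1 - x)⁺ * (1 - x)⁺ := by
        rw [← posPart_mul_self]; ring
    _ ≤ (1 - x)⁺ := sub_le_self _ (IsFAlgebra.mul_self_nonneg _)
    _ ≤ 1 := sup_le (sub_le_self _ hx) zero_le_one

variable {A : Type*} [ConditionallyCompleteLattice A] [CommRing A] [Algebra ℝ A] [IsFAlgebra A]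

theorem nonpos_of_mul_self_eq_zero {x : A} (h : x * x = 0) : x ≤ 0 := by
  have htwo : (2 : ℝ) • x ≤ 0 := nonpos_of_forall_nsmul_le (y := 1) fun n =>
    calc n • (2 : ℝ) • x = 1 - (1 - n * x) * (1 - n * x) := by
          rw [two_smul, nsmul_eq_mul]; linear_combination (n : A) * n * h
      _ ≤ 1 := sub_le_self _ (IsFAlgebra.mul_self_nonneg _)
  exact (smul_nonpos_iff_nonpos_of_pos_left two_pos).1 htwo

instance IsFAlgebra.isReduced : IsReduced A :=
  (isReduced_iff_pow_one_lt 2 one_lt_two).2 fun x h => by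
    rw [sq] at h
    exact le_antisymm (nonpos_of_mul_self_eq_zero h)
      (neg_nonpos.1 (nonpos_of_mul_self_eq_zero (by rwa [neg_mul_neg])))

theorem inf_eq_zero_of_mul_eq_zero {x y : A} (hx : 0 ≤ x) (hy : 0 ≤ y) (h : x * y = 0) :
    x ⊓ y = 0 := by
  have hinf : 0 ≤ x ⊓ y := le_inf hx hy
  refine pow_eq_zero_iff two_ne_zero |>.1 (le_antisymm ?_ (pow_nonneg hinf 2))
  calc (x ⊓ y) ^ 2 = (x ⊓ y) * (x ⊓ y) := sq _
    _ ≤ x * y := mul_le_mul inf_le_left inf_le_right hinf hx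
    _ = 0 := h

theorem le_of_mul_self_le_mul_self {x y : A} (hy : 0 ≤ y) (h : x * x ≤ y * y) : x ≤ y := by
  set d := (x - y)⁺
  have hd : 0 ≤ d := posPart_nonneg _
  have hd_mul : d * (x - y) = d * d := posPart_mul_self _
  have hcube : d ^ 3 ≤ 0 :=
    calc d ^ 3 ≤ d ^ 3 + 2 * (d * d * y) :=
          le_add_of_nonneg_right (mul_nonneg zero_le_two (mul_nonneg (mul_nonneg hd hd) hy))
      _ = d * (x * x - y * y) := by linear_combination -(d + x + y) * hd_mul
      _ ≤ 0 := mul_nonpos_of_nonneg_of_nonpos hd (sub_nonpos.2 h)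
  have hd_zero : d = 0 :=
    (pow_eq_zero_iff three_ne_zero).1 (le_antisymm hcube (pow_nonneg hd 3))
  exact sub_nonpos.1 (posPart_eq_zero.1 hd_zero)

end Semiprime

section WeakOrderUnit

variable {A : Type*} [ConditionallyCompleteLattice A] [CommRing A] [Algebra ℝ A] [IsFAlgebra A]

theorem isWeakOrderUnit_iff_mul {u : A} :
    IsWeakOrderUnit u ↔ 0 ≤ u ∧ ∀ x, 0 ≤ x → u * x = 0 → x = 0 := by
  refine and_congr_right fun hu => ⟨fun h x hx hux => h x ?_, fun h x hxu => ?_⟩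
  · rw [abs_of_nonneg hx, inf_comm]
    exact inf_eq_zero_of_mul_eq_zero hu hx hux
  · rw [inf_comm] at hxu
    exact eq_zero_of_abs_nonpos (h _ (abs_nonneg x) (mul_eq_zero_of_inf_eq_zero hxu)).le

theorem isWeakOrderUnit_of_one_le {u : A} (hu : 1 ≤ u) : IsWeakOrderUnit u :=
  isWeakOrderUnit_iff_mul.2 ⟨zero_le_one.trans hu, fun _ hx hux =>
    le_antisymm ((le_mul_of_one_le_left hx hu).trans hux.le) hx⟩

theorem IsWeakOrderUnit.mul {u v : A} (hu : IsWeakOrderUnit u) (hv : IsWeakOrderUnit v) :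
    IsWeakOrderUnit (u * v) := by
  rw [isWeakOrderUnit_iff_mul] at *
  exact ⟨mul_nonneg hu.1 hv.1, fun x hx h =>
    hv.2 x hx (hu.2 _ (mul_nonneg hv.1 hx) (by rwa [← mul_assoc]))⟩

theorem IsWeakOrderUnit.pow {u : A} (hu : IsWeakOrderUnit u) (n : ℕ) :
    IsWeakOrderUnit (u ^ n) := by
  induction n with
  | zero => exact isWeakOrderUnit_of_one_le (pow_zero u).ge
  | succ n ih => exact pow_succ u n ▸ ih.mul hu

theorem IsWeakOrderUnit.le_of_mul_le_mul_left {u x y : A} (hu : IsWeakOrderUnit u)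
    (h : u * x ≤ u * y) : x ≤ y := by
  obtain ⟨hu₀, hu_cancel⟩ := isWeakOrderUnit_iff_mul.1 hu
  set d := (x - y)⁺
  have hd : 0 ≤ d := posPart_nonneg _
  have hle : u * d ^ 2 ≤ 0 :=
    calc u * d ^ 2 = d * (u * x - u * y) := by
          linear_combination -u * posPart_mul_self (x - y)
      _ ≤ 0 := mul_nonpos_of_nonneg_of_nonpos hd (sub_nonpos.2 h)
  have hd_sq : d ^ 2 = 0 :=
    hu_cancel _ (pow_nonneg hd 2) (le_antisymm hle (mul_nonneg hu₀ (pow_nonneg hd 2)))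
  exact sub_nonpos.1 (posPart_eq_zero.1 ((pow_eq_zero_iff two_ne_zero).1 hd_sq))

theorem eq_zero_of_forall_mul_le {u w : A} (hu : 0 ≤ u) (hw : 0 ≤ w)
    (h : ∀ x, 0 ≤ x → u * x ≤ w → x ≤ 0) : w = 0 := by
  refine le_antisymm (nonpos_of_forall_le_inv_smul (y := u * w) fun n hn => ?_) hw
  set t : ℝ := (n : ℝ)⁻¹
  have ht : 0 < t := inv_pos.2 (Nat.cast_pos.2 hn)
  have hproj : 0 ≤ (1 - t • u)⁺ * w := mul_nonneg (posPart_nonneg _) hw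
  have htest : u * t • ((1 - t • u)⁺ * w) ≤ w :=
    calc u * t • ((1 - t • u)⁺ * w) = (t • u * (1 - t • u)⁺) * w := by
          simp only [Algebra.smul_def]; ring
      _ ≤ 1 * w :=
        mul_le_mul_of_nonneg_right (mul_posPart_one_sub_le_one (smul_nonneg ht.le hu)) hw
      _ = w := one_mul w
  have hle : (1 - t • u) * w ≤ 0 :=
    (mul_le_mul_of_nonneg_right (le_posPart _) hw).trans
      ((smul_nonpos_iff_nonpos_of_pos_left ht).1 (h _ (smul_nonneg ht.le hproj) htest))
  rwa [sub_mul, one_mul, smul_mul_assoc, sub_nonpos] at hle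

theorem IsWeakOrderUnit.exists_mul_eq {u w W : A} (hu : IsWeakOrderUnit u) (hw : 0 ≤ w)
    (hW : w ≤ u * W) : ∃ v, u * v = w := by
  set S : Set A := {x | u * x ≤ w}
  have hS : BddAbove S := ⟨W, fun x hx => hu.le_of_mul_le_mul_left (le_trans hx hW)⟩
  have hS₀ : (0 : A) ∈ S := (mul_zero u).trans_le hw
  have hle : u * sSup S ≤ w := by
    refine sub_nonpos.1 (posPart_eq_zero.1 (eq_zero_of_forall_mul_le hu.1 (posPart_nonneg _)
      fun x _ hx => ?_))
    have hbound : ∀ y ∈ S, y ≤ sSup S - x := fun y hy => by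
      refine le_sub_comm.1 (hu.le_of_mul_le_mul_left (hx.trans (sup_le ?_ ?_)))
      · rw [mul_sub]
        exact sub_le_sub_left hy _
      · exact mul_nonneg hu.1 (sub_nonneg.2 (le_csSup hS hy))
    exact (le_sub_self_iff _).1 (csSup_le ⟨0, hS₀⟩ hbound)
  refine ⟨sSup S, (sub_eq_zero.1 (eq_zero_of_forall_mul_le hu.1 (sub_nonneg.2 hle)
    fun x _ hx => ?_)).symm⟩
  have hmem : sSup S + x ∈ S := by
    change u * (sSup S + x) ≤ w
    rw [mul_add]
    exact le_sub_iff_add_le'.1 hx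
  exact (add_le_iff_nonpos_right _).1 (le_csSup hS hmem)

end WeakOrderUnit

section DecreasesToZero

theorem DecreasesToZero.nonneg {A : Type*} [Lattice A] [Zero A] {p : ℕ → A}
    (hp : DecreasesToZero p) (n : ℕ) : 0 ≤ p n :=
  hp.2.1 ⟨n, rfl⟩

theorem DecreasesToZero.nonpos_of_forall_le {A : Type*} [Lattice A] [Zero A] {p : ℕ → A}
    (hp : DecreasesToZero p) {w : A} (h : ∀ n, w ≤ p n) : w ≤ 0 :=
  hp.2.2 (Set.forall_mem_range.2 h)

theorem decreasesToZero_of_antitone {A : Type*} [Lattice A] [Zero A] {p : ℕ → A}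
    (hp : Antitone p) (hnonneg : ∀ n, 0 ≤ p n) (h : ∀ w, (∀ n, w ≤ p n) → w ≤ 0) :
    DecreasesToZero p :=
  ⟨hp, Set.forall_mem_range.2 hnonneg, fun w hw => h w (Set.forall_mem_range.1 hw)⟩

theorem decreasesToZero_sub_iInf {A : Type*} [ConditionallyCompleteLattice A] [AddCommGroup A]
    [IsOrderedAddMonoid A] {f : ℕ → A} (hf : Antitone f) (hbdd : BddBelow (Set.range f)) :
    DecreasesToZero fun n => f n - ⨅ m, f m :=
  decreasesToZero_of_antitone (fun _ _ h => sub_le_sub_right (hf h) _)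
    (fun n => sub_nonneg.2 (ciInf_le hbdd n)) fun w hw => by
      have hle : w + ⨅ m, f m ≤ ⨅ m, f m := le_ciInf fun n => le_sub_iff_add_le.1 (hw n)
      exact add_le_iff_nonpos_left.1 hle

theorem DecreasesToZero.add {A : Type*} [Lattice A] [AddCommGroup A] [IsOrderedAddMonoid A]
    {p q : ℕ → A} (hp : DecreasesToZero p) (hq : DecreasesToZero q) :
    DecreasesToZero fun n => p n + q n := by
  refine decreasesToZero_of_antitone (fun _ _ h => add_le_add (hp.1 h) (hq.1 h))
    (fun n => add_nonneg (hp.nonneg n) (hq.nonneg n)) fun w hw => ?_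
  refine hp.nonpos_of_forall_le fun n => sub_nonpos.1 (hq.nonpos_of_forall_le fun m => ?_)
  rw [sub_le_iff_le_add']
  exact (hw (max n m)).trans (add_le_add (hp.1 (le_max_left n m)) (hq.1 (le_max_right n m)))

variable {A : Type*} [ConditionallyCompleteLattice A] [Ring A] [Algebra ℝ A] [IsFAlgebra A]

theorem DecreasesToZero.mul_left {p : ℕ → A} (hp : DecreasesToZero p) {c : A} (hc : 0 ≤ c) :
    DecreasesToZero fun n => c * p n := by
  refine decreasesToZero_of_antitone (fun _ _ h => mul_le_mul_of_nonneg_left (hp.1 h) hc)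
    (fun n => mul_nonneg hc (hp.nonneg n)) fun w hw => ?_
  refine nonpos_of_forall_le_inv_smul (y := c * c * p 0) fun l hl => ?_
  have hl' : (0 : ℝ) < l := Nat.cast_pos.2 hl
  have hc_le : c ≤ (l : ℝ) • 1 + (l : ℝ)⁻¹ • (c * c) :=
    sub_le_iff_le_add'.1 ((le_posPart _).trans (posPart_sub_smul_one_le hc hl'))
  have hlower : ∀ n, (l : ℝ)⁻¹ • (w - (l : ℝ)⁻¹ • (c * c * p 0)) ≤ p n := fun n => by
    rw [inv_smul_le_iff_of_pos hl', sub_le_iff_le_add]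
    calc w ≤ c * p n := hw n
      _ ≤ ((l : ℝ) • 1 + (l : ℝ)⁻¹ • (c * c)) * p n :=
        mul_le_mul_of_nonneg_right hc_le (hp.nonneg n)
      _ = (l : ℝ) • p n + (l : ℝ)⁻¹ • (c * c * p n) := by
        rw [add_mul, smul_mul_assoc, smul_mul_assoc, one_mul]
      _ ≤ (l : ℝ) • p n + (l : ℝ)⁻¹ • (c * c * p 0) := by
        have := mul_nonneg hc hc
        have := hp.1 n.zero_le
        gcongr
  exact sub_nonpos.1
    ((smul_nonpos_iff_nonpos_of_pos_left (inv_pos.2 hl')).1 (hp.nonpos_of_forall_le hlower))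

end DecreasesToZero

section LaterallyComplete

theorem bddAbove_range_of_pairwise_inf_eq_zero {A : Type*} [Lattice A] [Zero A]
    [IsLaterallyComplete A] {f : ℕ → A} (hf : ∀ n, 0 ≤ f n)
    (hdisj : Pairwise fun m n => f m ⊓ f n = 0) :
    BddAbove (Set.range f) := by
  obtain ⟨W, hW⟩ := IsLaterallyComplete.exists_isLUB (Set.range f) (Set.range_nonempty f)
    (Set.forall_mem_range.2 hf) (by
      rintro _ ⟨m, rfl⟩ _ ⟨n, rfl⟩ hne
      exact hdisj fun h => hne (congrArg f h))
  exact ⟨W, hW.1⟩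

variable {A : Type*} [ConditionallyCompleteLattice A] [CommRing A]

/-- For `y ≥ 0`, the component of the unit `1` disjoint from `y`: the idempotent which projects onto
the elements annihilated by `y`. -/
noncomputable def nullComponent (y : A) : A :=
  ⨅ m : ℕ, (1 - m • y)⁺

theorem bddBelow_range_posPart_one_sub_nsmul (y : A) :
    BddBelow (Set.range fun m : ℕ => (1 - m • y)⁺) :=
  ⟨0, Set.forall_mem_range.2 fun _ => posPart_nonneg _⟩

theorem nullComponent_nonneg (y : A) : 0 ≤ nullComponent y :=
  le_ciInf fun _ => posPart_nonneg _

theorem nullComponent_le (y : A) (m : ℕ) : nullComponent y ≤ (1 - m • y)⁺ :=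
  ciInf_le (bddBelow_range_posPart_one_sub_nsmul y) m

variable [Algebra ℝ A] [IsFAlgebra A]

theorem nullComponent_le_one (y : A) : nullComponent y ≤ 1 := by
  simpa using nullComponent_le y 0

theorem nullComponent_zero : nullComponent (0 : A) = 1 := by
  simp [nullComponent]

theorem mul_nullComponent {y : A} (hy : 0 ≤ y) : y * nullComponent y = 0 := by
  refine le_antisymm (nonpos_of_forall_nsmul_le (y := 1) fun m => ?_)
    (mul_nonneg hy (nullComponent_nonneg y))
  calc m • (y * nullComponent y) = m • y * nullComponent y := (smul_mul_assoc m y _).symm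
    _ ≤ m • y * (1 - m • y)⁺ :=
      mul_le_mul_of_nonneg_left (nullComponent_le y m) (nsmul_nonneg hy m)
    _ ≤ 1 := mul_posPart_one_sub_le_one (nsmul_nonneg hy m)

theorem mul_nullComponent_of_mul_eq_zero {x y : A} (hx : 0 ≤ x) (hy : 0 ≤ y) (h : x * y = 0) :
    x * nullComponent y = x := by
  have hanti : Antitone fun m : ℕ => (1 - m • y)⁺ := fun _ _ hmn =>
    posPart_mono (sub_le_sub_left (nsmul_le_nsmul_left hy hmn) 1)
  have hlower : ∀ m : ℕ, x - x * nullComponent y ≤ x * ((1 - m • y)⁺ - nullComponent y) := by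
    intro m
    rw [mul_sub]
    refine sub_le_sub_right ?_ _
    calc x = x * (1 - m • y) := by rw [mul_sub, mul_smul_comm, h, smul_zero, sub_zero, mul_one]
      _ ≤ x * (1 - m • y)⁺ := mul_le_mul_of_nonneg_left (le_posPart _) hx
  refine le_antisymm (mul_le_of_le_one_right hx (nullComponent_le_one y)) (sub_nonpos.1 ?_)
  exact ((decreasesToZero_sub_iInf hanti
    (bddBelow_range_posPart_one_sub_nsmul y)).mul_left hx).nonpos_of_forall_le hlower

theorem nullComponent_mul_nullComponent {x y : A} (hx : 0 ≤ x) (hxy : x ≤ y) :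
    nullComponent y * nullComponent x = nullComponent y := by
  refine mul_nullComponent_of_mul_eq_zero (nullComponent_nonneg y) hx (le_antisymm ?_
    (mul_nonneg (nullComponent_nonneg y) hx))
  rw [mul_comm, ← mul_nullComponent (hx.trans hxy)]
  exact mul_le_mul_of_nonneg_right hxy (nullComponent_nonneg y)

theorem one_sub_nullComponent_posPart_mul_nonneg (x : A) :
    0 ≤ (1 - nullComponent x⁺) * x := by
  have hneg : x⁻ * nullComponent x⁺ = x⁻ :=
    mul_nullComponent_of_mul_eq_zero (negPart_nonneg x) (posPart_nonneg x)
      (mul_eq_zero_of_inf_eq_zero ((inf_comm _ _).trans (posPart_inf_negPart_eq_zero x)))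
  calc 0 ≤ (1 - nullComponent x⁺) * x⁺ :=
        mul_nonneg (sub_nonneg.2 (nullComponent_le_one _)) (posPart_nonneg x)
    _ = (1 - nullComponent x⁺) * x := by
        linear_combination (1 - nullComponent x⁺) * posPart_sub_negPart x - hneg

theorem nullComponent_posPart_mul_nonpos (x : A) : nullComponent x⁺ * x ≤ 0 :=
  calc nullComponent x⁺ * x = -(nullComponent x⁺ * x⁻) := by
        linear_combination mul_nullComponent (posPart_nonneg x) -
          nullComponent x⁺ * posPart_sub_negPart x
    _ ≤ 0 := neg_nonpos.2 (mul_nonneg (nullComponent_nonneg _) (negPart_nonneg x))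

/-- For `u ≥ 0`, the component of the unit on which `n • u ≤ 1`. -/
noncomputable def sublevelComponent (u : A) (n : ℕ) : A :=
  nullComponent (n • u - 1)⁺

theorem sublevelComponent_zero (u : A) : sublevelComponent u 0 = 1 := by
  have hpos : (0 • u - 1)⁺ = 0 := by simp
  rw [sublevelComponent, hpos, nullComponent_zero]

theorem sublevelComponent_mul {u : A} (hu : 0 ≤ u) {m n : ℕ} (h : m ≤ n) :
    sublevelComponent u m * sublevelComponent u n = sublevelComponent u n := by
  rw [mul_comm]
  exact nullComponent_mul_nullComponent (posPart_nonneg _)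
    (posPart_mono (sub_le_sub_right (nsmul_le_nsmul_left hu h) 1))

theorem nsmul_mul_sublevelComponent_le (u : A) (n : ℕ) :
    n • (u * sublevelComponent u n) ≤ sublevelComponent u n := by
  have h : sublevelComponent u n * (n • u - 1) ≤ 0 := nullComponent_posPart_mul_nonpos _
  rwa [mul_sub, mul_one, sub_nonpos, mul_smul_comm, mul_comm] at h

/-- For `u ≥ 0`, the component of the unit on which `n • u ≤ 1 < (n + 1) • u`. -/
noncomputable def levelComponent (u : A) (n : ℕ) : A :=
  sublevelComponent u n - sublevelComponent u (n + 1)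

theorem sum_levelComponent (u : A) (n : ℕ) :
    ∑ i ∈ Finset.range n, levelComponent u i = 1 - sublevelComponent u n := by
  simp only [levelComponent, Finset.sum_range_sub', sublevelComponent_zero]

theorem levelComponent_nonneg {u : A} (hu : 0 ≤ u) (n : ℕ) : 0 ≤ levelComponent u n :=
  sub_nonneg.2 ((sublevelComponent_mul hu n.le_succ).ge.trans
    (mul_le_of_le_one_right (nullComponent_nonneg _) (nullComponent_le_one _)))

theorem levelComponent_mul_self {u : A} (hu : 0 ≤ u) (n : ℕ) :
    levelComponent u n * levelComponent u n = levelComponent u n := by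
  simp only [levelComponent]
  linear_combination sublevelComponent_mul hu (le_refl n) -
    2 * sublevelComponent_mul hu n.le_succ + sublevelComponent_mul hu (le_refl (n + 1))

theorem levelComponent_mul_of_lt {u : A} (hu : 0 ≤ u) {m n : ℕ} (h : m < n) :
    levelComponent u m * levelComponent u n = 0 := by
  simp only [levelComponent]
  linear_combination sublevelComponent_mul hu h.le -
    sublevelComponent_mul hu (h.le.trans n.le_succ) - sublevelComponent_mul hu (Nat.succ_le_of_lt h)
    + sublevelComponent_mul hu (Nat.succ_le_succ h.le)

theorem levelComponent_le_mul {u : A} (hu : 0 ≤ u) (n : ℕ) :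
    levelComponent u n ≤ u * ((n + 1) • levelComponent u n) := by
  have h : 0 ≤ (1 - sublevelComponent u (n + 1)) * ((n + 1) • u - 1) :=
    one_sub_nullComponent_posPart_mul_nonneg _
  refine sub_nonneg.1 ((mul_nonneg (levelComponent_nonneg hu n) h).trans_eq ?_)
  simp only [levelComponent, nsmul_eq_mul]
  linear_combination (1 - ((n + 1 : ℕ) : A) * u) * (sublevelComponent_mul hu n.le_succ
    - sublevelComponent_mul hu (le_refl (n + 1)))

theorem bddAbove_range_nsmul_levelComponent [IsLaterallyComplete A] {u : A} (hu : 0 ≤ u) :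
    BddAbove (Set.range fun n => (n + 1) • levelComponent u n) := by
  have hnonneg : ∀ n, 0 ≤ (n + 1) • levelComponent u n := fun n =>
    nsmul_nonneg (levelComponent_nonneg hu n) _
  refine bddAbove_range_of_pairwise_inf_eq_zero hnonneg fun m n hmn =>
    inf_eq_zero_of_mul_eq_zero (hnonneg m) (hnonneg n) ?_
  rw [smul_mul_smul_comm]
  rcases hmn.lt_or_gt with h | h
  · rw [levelComponent_mul_of_lt hu h, smul_zero]
  · rw [mul_comm (levelComponent u m), levelComponent_mul_of_lt hu h, smul_zero]

theorem IsWeakOrderUnit.exists_one_le_mul [IsLaterallyComplete A] {u : A}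
    (hu : IsWeakOrderUnit u) : ∃ W, 1 ≤ u * W := by
  obtain ⟨W, hW⟩ := bddAbove_range_nsmul_levelComponent hu.1
  have hW' : ∀ n, (n + 1) • levelComponent u n ≤ W := Set.forall_mem_range.1 hW
  have hW₀ : 0 ≤ W := (nsmul_nonneg (levelComponent_nonneg hu.1 0) _).trans (hW' 0)
  have hlevel : ∀ n, levelComponent u n ≤ levelComponent u n * (u * W) := fun n =>
    calc levelComponent u n = levelComponent u n * levelComponent u n :=
          (levelComponent_mul_self hu.1 n).symm
      _ ≤ levelComponent u n * (u * ((n + 1) • levelComponent u n)) :=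
        mul_le_mul_of_nonneg_left (levelComponent_le_mul hu.1 n) (levelComponent_nonneg hu.1 n)
      _ ≤ levelComponent u n * (u * W) :=
        mul_le_mul_of_nonneg_left (mul_le_mul_of_nonneg_left (hW' n) hu.1)
          (levelComponent_nonneg hu.1 n)
  have hle : ∀ n, 1 - u * W ≤ sublevelComponent u n := fun n => by
    have hsum := Finset.sum_le_sum fun i (_ : i ∈ Finset.range n) => hlevel i
    rw [← Finset.sum_mul, sum_levelComponent, sub_mul, one_mul] at hsum
    rw [sub_le_comm]
    exact hsum.trans (sub_le_self _ (mul_nonneg (nullComponent_nonneg _)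
      (mul_nonneg hu.1 hW₀)))
  refine ⟨W, sub_nonpos.1 (hu.le_of_mul_le_mul_left ?_)⟩
  rw [mul_zero]
  refine nonpos_of_forall_nsmul_le (y := 1) fun n => ?_
  calc n • (u * (1 - u * W)) ≤ n • (u * sublevelComponent u n) :=
        nsmul_le_nsmul_right (mul_le_mul_of_nonneg_left (hle n) hu.1) n
    _ ≤ sublevelComponent u n := nsmul_mul_sublevelComponent_le u n
    _ ≤ 1 := nullComponent_le_one _

theorem IsWeakOrderUnit.isUnit [IsLaterallyComplete A] {u : A} (hu : IsWeakOrderUnit u) :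
    IsUnit u := by
  obtain ⟨W, hW⟩ := hu.exists_one_le_mul
  obtain ⟨v, hv⟩ := hu.exists_mul_eq zero_le_one hW
  exact IsUnit.of_mul_eq_one v hv

theorem exists_forall_le_mul_of_isOrderBounded_mul_inverse [IsLaterallyComplete A] {ι : Type*}
    {x d : ι → A} (hd : ∀ k, IsWeakOrderUnit (d k))
    (h : IsOrderBounded (Set.range fun k => x k * Ring.inverse (d k))) :
    ∃ K, ∀ k, x k ≤ K * d k := by
  obtain ⟨_, K, hK⟩ := h
  refine ⟨K, fun k => ?_⟩
  calc x k = x k * Ring.inverse (d k) * d k :=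
        (Ring.inverse_mul_cancel_right _ _ (hd k).isUnit).symm
    _ ≤ K * d k := mul_le_mul_of_nonneg_right (hK ⟨k, rfl⟩).2 (hd k).1

end LaterallyComplete

section Modulus

theorem smul_le_abs {A : Type*} [Lattice A] [AddCommGroup A] [IsOrderedAddMonoid A] [Module ℝ A]
    [IsOrderedModule ℝ A] {c : ℝ} (hc : |c| ≤ 1) (x : A) : c • x ≤ |x| := by
  have hcx : |c| • |x| ≤ |x| := by simpa using smul_le_smul_of_nonneg_right hc (abs_nonneg x)
  refine le_trans ?_ hcx
  rcases abs_cases c with ⟨h, h₀⟩ | ⟨h, h₀⟩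
  · rw [h]
    exact smul_le_smul_of_nonneg_left (le_abs_self x) h₀
  · rw [h, ← neg_smul_neg]
    exact smul_le_smul_of_nonneg_left (neg_le_abs x) (neg_nonneg.2 h₀.le)

namespace Cplx

theorem modulus_le {A : Type*} [ConditionallyCompleteLattice A] [Ring A] [Algebra ℝ A]
    {z : Cplx A} {b : A} (h : ∀ θ : ℝ, Real.cos θ • z.re + Real.sin θ • z.im ≤ b) :
    z.modulus ≤ b :=
  csSup_le ((Set.nonempty_Icc.2 Real.two_pi_pos.le).image _) (by rintro _ ⟨θ, -, rfl⟩; exact h θ)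

theorem cos_smul_re_add_sin_smul_im_le {A : Type*} [Lattice A] [Ring A] [Algebra ℝ A]
    [IsFAlgebra A] (z : Cplx A) (θ : ℝ) :
    Real.cos θ • z.re + Real.sin θ • z.im ≤ |z.re| + |z.im| :=
  add_le_add (smul_le_abs (Real.abs_cos_le_one θ) _) (smul_le_abs (Real.abs_sin_le_one θ) _)

variable {A : Type*} [ConditionallyCompleteLattice A] [Ring A] [Algebra ℝ A] [IsFAlgebra A]

theorem le_modulus (z : Cplx A) (θ : ℝ) :
    Real.cos θ • z.re + Real.sin θ • z.im ≤ z.modulus := by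
  have hbdd : BddAbove ((fun θ : ℝ => Real.cos θ • z.re + Real.sin θ • z.im) ''
      Set.Icc 0 (2 * Real.pi)) :=
    ⟨|z.re| + |z.im|, by rintro _ ⟨θ, -, rfl⟩; exact cos_smul_re_add_sin_smul_im_le z θ⟩
  have hperiodic : Function.Periodic (fun θ : ℝ => Real.cos θ • z.re + Real.sin θ • z.im)
      (2 * Real.pi) := fun θ => by simp
  obtain ⟨φ, hφ, h⟩ := hperiodic.exists_mem_Ico₀ Real.two_pi_pos θ
  exact h.trans_le (le_csSup hbdd ⟨φ, Set.Ico_subset_Icc_self hφ, rfl⟩)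

theorem abs_cos_smul_re_add_sin_smul_im_le_modulus (z : Cplx A) (θ : ℝ) :
    |Real.cos θ • z.re + Real.sin θ • z.im| ≤ z.modulus :=
  abs_le'.2 ⟨le_modulus z θ, by simpa [add_comm] using le_modulus z (θ + Real.pi)⟩

theorem abs_re_le_modulus (z : Cplx A) : |z.re| ≤ z.modulus := by
  simpa using abs_cos_smul_re_add_sin_smul_im_le_modulus z 0

theorem abs_im_le_modulus (z : Cplx A) : |z.im| ≤ z.modulus := by
  simpa using abs_cos_smul_re_add_sin_smul_im_le_modulus z (Real.pi / 2)

theorem modulus_le_abs_re_add_abs_im (z : Cplx A) : z.modulus ≤ |z.re| + |z.im| :=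
  modulus_le (cos_smul_re_add_sin_smul_im_le z)

theorem modulus_nonneg (z : Cplx A) : 0 ≤ z.modulus :=
  (abs_nonneg z.re).trans (abs_re_le_modulus z)

theorem modulus_ofReal {x : A} (hx : 0 ≤ x) : (ofReal x).modulus = x :=
  le_antisymm
    (by simpa [ofReal, abs_of_nonneg hx] using modulus_le_abs_re_add_abs_im (ofReal x))
    ((le_abs_self x).trans (abs_re_le_modulus (ofReal x)))

theorem modulus_zero : (0 : Cplx A).modulus = 0 :=
  modulus_ofReal le_rfl

theorem eq_zero_of_modulus_nonpos {z : Cplx A} (h : z.modulus ≤ 0) : z = 0 :=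
  Cplx.ext (eq_zero_of_abs_nonpos ((abs_re_le_modulus z).trans h))
    (eq_zero_of_abs_nonpos ((abs_im_le_modulus z).trans h))

theorem modulus_add_le (z w : Cplx A) : (z + w).modulus ≤ z.modulus + w.modulus :=
  modulus_le fun θ => by
    calc Real.cos θ • (z + w).re + Real.sin θ • (z + w).im
        = (Real.cos θ • z.re + Real.sin θ • z.im) + (Real.cos θ • w.re + Real.sin θ • w.im) := by
          simp only [add_re, add_im]; module
      _ ≤ z.modulus + w.modulus := add_le_add (le_modulus z θ) (le_modulus w θ)

theorem modulus_neg_le (z : Cplx A) : (-z).modulus ≤ z.modulus :=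
  modulus_le fun θ => by simpa using le_modulus z (θ + Real.pi)

theorem modulus_sub_comm (z w : Cplx A) : (z - w).modulus = (w - z).modulus :=
  le_antisymm (by simpa using modulus_neg_le (w - z)) (by simpa using modulus_neg_le (z - w))

theorem modulus_sub_le (z w : Cplx A) : (z - w).modulus ≤ z.modulus + w.modulus := by
  rw [sub_eq_add_neg]
  exact (modulus_add_le z (-w)).trans (add_le_add_right (modulus_neg_le w) _)

theorem modulus_sub_le_add (x y z : Cplx A) :
    (x - z).modulus ≤ (x - y).modulus + (y - z).modulus := by
  simpa using modulus_add_le (x - y) (y - z)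

theorem modulus_sum_le {ι : Type*} (s : Finset ι) (f : ι → Cplx A) :
    (∑ i ∈ s, f i).modulus ≤ ∑ i ∈ s, (f i).modulus :=
  Finset.le_sum_of_subadditive _ modulus_zero.le modulus_add_le s f

end Cplx

end Modulus

section NormSq

theorem algebraMap_sin_sq_add_cos_sq {A : Type*} [Ring A] [Algebra ℝ A] (θ : ℝ) :
    algebraMap ℝ A (Real.sin θ) ^ 2 + algebraMap ℝ A (Real.cos θ) ^ 2 = 1 := by
  rw [← map_pow, ← map_pow, ← map_add, Real.sin_sq_add_cos_sq, map_one]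

namespace Cplx

variable {A : Type*} [CommRing A]

instance : CommRing (Cplx A) where
  mul_comm _ _ := by ext <;> simp only [mul_re, mul_im] <;> ring

/-- The squared modulus `f² + g²` of `f + ig`, computed inside the algebra instead of through the
supremum which defines the modulus. -/
def normSq (z : Cplx A) : A :=
  z.re * z.re + z.im * z.im

theorem normSq_mul (z w : Cplx A) : normSq (z * w) = normSq z * normSq w := by
  simp only [normSq, mul_re, mul_im]; ring

section Lattice

variable [Lattice A] [Algebra ℝ A] [IsFAlgebra A]

theorem normSq_nonneg (z : Cplx A) : 0 ≤ normSq z :=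
  add_nonneg (IsFAlgebra.mul_self_nonneg _) (IsFAlgebra.mul_self_nonneg _)

theorem cos_smul_re_add_sin_smul_im_mul_self_le_normSq (z : Cplx A) (θ : ℝ) :
    (Real.cos θ • z.re + Real.sin θ • z.im) * (Real.cos θ • z.re + Real.sin θ • z.im) ≤
      normSq z := by
  have hrot : normSq z =
      (Real.cos θ • z.re + Real.sin θ • z.im) * (Real.cos θ • z.re + Real.sin θ • z.im) +
        (Real.sin θ • z.re - Real.cos θ • z.im) * (Real.sin θ • z.re - Real.cos θ • z.im) := by
    simp only [normSq, Algebra.smul_def]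
    linear_combination -(z.re * z.re + z.im * z.im) * algebraMap_sin_sq_add_cos_sq (A := A) θ
  rw [hrot]
  exact le_add_of_nonneg_right (IsFAlgebra.mul_self_nonneg _)

end Lattice

variable [ConditionallyCompleteLattice A] [Algebra ℝ A] [IsFAlgebra A]

theorem modulus_mul_self_le (z : Cplx A) :
    (z * z).modulus ≤ (2 : ℝ) • (z.modulus * z.modulus) - normSq z := by
  refine modulus_le fun θ => ?_
  set c := Real.cos (θ / 2) with hc
  set s := Real.sin (θ / 2) with hs
  have hcos : Real.cos θ = c ^ 2 - s ^ 2 := by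
    rw [hc, hs, ← Real.cos_two_mul', mul_div_cancel₀ θ two_ne_zero]
  have hsin : Real.sin θ = 2 * s * c := by
    rw [hc, hs, ← Real.sin_two_mul, mul_div_cancel₀ θ two_ne_zero]
  calc Real.cos θ • (z * z).re + Real.sin θ • (z * z).im
      = (2 : ℝ) • ((c • z.re + s • z.im) * (c • z.re + s • z.im)) - normSq z := by
        simp only [hcos, hsin, normSq, mul_re, mul_im, Algebra.smul_def, map_sub, map_mul, map_pow,
          map_ofNat]
        linear_combination
          -(z.re * z.re + z.im * z.im) * algebraMap_sin_sq_add_cos_sq (A := A) (θ / 2)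
    _ ≤ (2 : ℝ) • (z.modulus * z.modulus) - normSq z :=
        sub_le_sub_right (smul_le_smul_of_nonneg_left (mul_self_le_mul_self_of_abs_le
          (abs_cos_smul_re_add_sin_smul_im_le_modulus z (θ / 2))) two_pos.le) _

theorem normSq_le_two_smul (z : Cplx A) : normSq z ≤ (2 : ℝ) • (z.modulus * z.modulus) := by
  rw [two_smul]
  exact add_le_add (mul_self_le_mul_self_of_abs_le (abs_re_le_modulus z))
    (mul_self_le_mul_self_of_abs_le (abs_im_le_modulus z))

theorem normSq_le_smul_of_forall_normSq_le_smul {C : ℝ} (hC : 1 ≤ C)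
    (h : ∀ z : Cplx A, normSq z ≤ (C * C) • (z.modulus * z.modulus)) (z : Cplx A) :
    normSq z ≤ C • (z.modulus * z.modulus) := by
  have hC₀ : 0 ≤ C := zero_le_one.trans hC
  have hsq : normSq z ≤ C • (z * z).modulus := by
    refine le_of_mul_self_le_mul_self (smul_nonneg hC₀ (modulus_nonneg _)) ?_
    rw [← normSq_mul, smul_mul_smul_comm]
    exact h (z * z)
  have hdouble : (1 + C) • normSq z ≤ (1 + C) • C • (z.modulus * z.modulus) :=
    calc (1 + C) • normSq z = normSq z + C • normSq z := by rw [add_smul, one_smul]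
      _ ≤ C • ((2 : ℝ) • (z.modulus * z.modulus) - normSq z) + C • normSq z :=
        add_le_add_left (hsq.trans (smul_le_smul_of_nonneg_left (modulus_mul_self_le z) hC₀)) _
      _ = (2 * C) • (z.modulus * z.modulus) := by module
      _ ≤ ((1 + C) * C) • (z.modulus * z.modulus) :=
        smul_le_smul_of_nonneg_right (by nlinarith) (IsFAlgebra.mul_self_nonneg _)
      _ = (1 + C) • C • (z.modulus * z.modulus) := mul_smul _ _ _
  exact le_of_smul_le_smul_left hdouble (by positivity)

theorem normSq_le_one_add_inv_smul {n : ℕ} (hn : 0 < n) :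
    ∀ z : Cplx A, normSq z ≤ (1 + (n : ℝ)⁻¹) • (z.modulus * z.modulus) := by
  induction n, hn using Nat.le_induction with
  | base =>
    intro z
    convert normSq_le_two_smul z using 2
    norm_num
  | succ n hn ih =>
    refine normSq_le_smul_of_forall_normSq_le_smul (le_add_of_nonneg_right (by positivity))
      fun z => (ih z).trans (smul_le_smul_of_nonneg_right ?_ (IsFAlgebra.mul_self_nonneg _))
    have hn' : (1 : ℝ) ≤ n := by exact_mod_cast hn
    have hinv : (n : ℝ)⁻¹ ≤ 2 * ((n + 1 : ℕ) : ℝ)⁻¹ := by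
      push_cast
      rw [← div_eq_mul_inv, inv_le_comm₀ (by positivity) (by positivity), inv_div]
      linarith
    nlinarith [sq_nonneg (((n + 1 : ℕ) : ℝ)⁻¹)]

theorem normSq_le_modulus_mul_self (z : Cplx A) : normSq z ≤ z.modulus * z.modulus := by
  refine sub_nonpos.1 (nonpos_of_forall_le_inv_smul (y := z.modulus * z.modulus) fun n hn => ?_)
  rw [sub_le_iff_le_add']
  simpa [add_smul] using normSq_le_one_add_inv_smul hn z

theorem modulus_mul_le (z w : Cplx A) : (z * w).modulus ≤ z.modulus * w.modulus := by
  refine modulus_le fun θ => le_of_mul_self_le_mul_self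
    (mul_nonneg (modulus_nonneg z) (modulus_nonneg w)) ?_
  calc _ ≤ normSq (z * w) := cos_smul_re_add_sin_smul_im_mul_self_le_normSq (z * w) θ
    _ = normSq z * normSq w := normSq_mul z w
    _ ≤ (z.modulus * z.modulus) * (w.modulus * w.modulus) :=
      mul_le_mul (normSq_le_modulus_mul_self z) (normSq_le_modulus_mul_self w) (normSq_nonneg w)
        (IsFAlgebra.mul_self_nonneg _)
    _ = (z.modulus * w.modulus) * (z.modulus * w.modulus) := mul_mul_mul_comm _ _ _ _

theorem modulus_mul_le_of_le {z w : Cplx A} {b c : A} (hz : z.modulus ≤ b) (hw : w.modulus ≤ c) :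
    (z * w).modulus ≤ b * c :=
  (modulus_mul_le z w).trans
    (mul_le_mul hz hw (modulus_nonneg w) ((modulus_nonneg z).trans hz))

theorem modulus_pow_le_of_le {z : Cplx A} {r : A} (h : z.modulus ≤ r) (n : ℕ) :
    (z ^ n).modulus ≤ r ^ n := by
  induction n with
  | zero => rw [pow_zero, pow_zero]; exact (modulus_ofReal zero_le_one).le
  | succ n ih => simpa only [pow_succ] using modulus_mul_le_of_le ih h

theorem ofReal_pow {A : Type*} [Ring A] (x : A) (n : ℕ) : ofReal (x ^ n) = ofReal x ^ n := by
  induction n with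
  | zero => rw [pow_zero, pow_zero]; rfl
  | succ n ih => rw [pow_succ, pow_succ, ← ih]; ext <;> simp [ofReal]

theorem modulus_le_of_modulus_mul_ofReal_le {u b : A} (hu : IsWeakOrderUnit u) {w : Cplx A}
    (h : (w * ofReal u).modulus ≤ b * u) : w.modulus ≤ b := by
  refine modulus_le fun θ => hu.le_of_mul_le_mul_left ?_
  calc u * (Real.cos θ • w.re + Real.sin θ • w.im)
      = Real.cos θ • (w * ofReal u).re + Real.sin θ • (w * ofReal u).im := by
        simp [ofReal, Algebra.smul_def]; ring
    _ ≤ b * u := (le_modulus _ θ).trans h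
    _ = u * b := mul_comm b u

end Cplx

end NormSq

section OrderConvergence

theorem exists_forall_abs_sub_le_of_cauchy {A : Type*} [ConditionallyCompleteLattice A]
    [AddCommGroup A] [IsOrderedAddMonoid A] {y q : ℕ → A}
    (h : ∀ N M, N ≤ M → |y M - y N| ≤ q N) : ∃ l, ∀ N, |y N - l| ≤ q N := by
  have hcross : ∀ N M, y N - q N ≤ y M + q M := fun N M =>
    calc y N - q N ≤ y (max N M) :=
          sub_le_comm.1 ((le_abs_self _).trans
            ((abs_sub_comm _ _).trans_le (h N _ (le_max_left N M))))
      _ ≤ y M + q M :=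
          sub_le_iff_le_add'.1 ((le_abs_self _).trans (h M _ (le_max_right N M)))
  have hbdd : BddAbove (Set.range fun N => y N - q N) :=
    ⟨y 0 + q 0, Set.forall_mem_range.2 fun N => hcross N 0⟩
  refine ⟨⨆ N, (y N - q N), fun N => abs_le'.2 ⟨sub_le_comm.1 (le_ciSup hbdd N), ?_⟩⟩
  rw [neg_sub, sub_le_iff_le_add']
  exact ciSup_le fun M => hcross M N

variable {A : Type*} [ConditionallyCompleteLattice A] [Ring A] [Algebra ℝ A] [IsFAlgebra A]

theorem OrderTendsto.unique {x : ℕ → Cplx A} {l l' : Cplx A} (hl : OrderTendsto x l)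
    (hl' : OrderTendsto x l') : l = l' := by
  obtain ⟨p, hp, hl⟩ := hl
  obtain ⟨q, hq, hl'⟩ := hl'
  refine sub_eq_zero.1 (Cplx.eq_zero_of_modulus_nonpos
    ((hp.add hq).nonpos_of_forall_le fun n => ?_))
  exact (Cplx.modulus_sub_le_add l (x n) l').trans
    (add_le_add ((Cplx.modulus_sub_comm _ _).trans_le (hl n)) (hl' n))

theorem DecreasesToZero.exists_forall_modulus_sub_le {q : ℕ → A} (hq : DecreasesToZero q)
    {x : ℕ → Cplx A} (h : ∀ N M, N ≤ M → (x M - x N).modulus ≤ q N) :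
    ∃ l, ∀ N, (x N - l).modulus ≤ q N := by
  obtain ⟨f, hf⟩ := exists_forall_abs_sub_le_of_cauchy (y := fun n => (x n).re)
    fun N M hNM => (Cplx.abs_re_le_modulus (x M - x N)).trans (h N M hNM)
  obtain ⟨g, hg⟩ := exists_forall_abs_sub_le_of_cauchy (y := fun n => (x n).im)
    fun N M hNM => (Cplx.abs_im_le_modulus (x M - x N)).trans (h N M hNM)
  have hlim : ∀ n, (x n - ⟨f, g⟩).modulus ≤ 2 * q n := fun n => by
    rw [two_mul]
    exact (Cplx.modulus_le_abs_re_add_abs_im _).trans (add_le_add (hf n) (hg n))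
  refine ⟨⟨f, g⟩, fun N => sub_nonpos.1 ?_⟩
  refine (hq.mul_left zero_le_two).nonpos_of_forall_le fun M => ?_
  rw [sub_le_iff_le_add']
  calc (x N - ⟨f, g⟩).modulus
      ≤ (x N - x (max N M)).modulus + (x (max N M) - ⟨f, g⟩).modulus :=
        Cplx.modulus_sub_le_add _ _ _
    _ ≤ q N + 2 * q (max N M) :=
        add_le_add ((Cplx.modulus_sub_comm _ _).trans_le (h N _ (le_max_left N M))) (hlim _)
    _ ≤ q N + 2 * q M :=
        add_le_add_right (mul_le_mul_of_nonneg_left (hq.1 (le_max_right N M)) zero_le_two) _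

theorem decreasesToZero_iInf_add_mul {p q Q : ℕ → A} (hp : DecreasesToZero p)
    (hq : DecreasesToZero q) (hQ : ∀ m, 0 ≤ Q m) :
    DecreasesToZero fun k => ⨅ m, (p m + Q m * q k) := by
  have hnonneg : ∀ k m, 0 ≤ p m + Q m * q k := fun k m =>
    add_nonneg (hp.nonneg m) (mul_nonneg (hQ m) (hq.nonneg k))
  have hbdd : ∀ k, BddBelow (Set.range fun m => p m + Q m * q k) := fun k =>
    ⟨0, Set.forall_mem_range.2 (hnonneg k)⟩
  refine decreasesToZero_of_antitone
    (fun k l hkl => ciInf_mono (hbdd l) fun m =>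
      add_le_add_right (mul_le_mul_of_nonneg_left (hq.1 hkl) (hQ m)) _)
    (fun k => le_ciInf (hnonneg k)) fun w hw => hp.nonpos_of_forall_le fun m => sub_nonpos.1 ?_
  exact (hq.mul_left (hQ m)).nonpos_of_forall_le fun k =>
    sub_le_iff_le_add'.2 ((hw k).trans (ciInf_le (hbdd k) m))

end OrderConvergence

section PowerSeries

open Cplx

theorem partialSum_succ {A : Type*} [Ring A] (a : ℕ → Cplx A) (z : Cplx A) (m : ℕ) :
    partialSum a z (m + 1) = partialSum a z m + a (m + 1) * z ^ (m + 1) :=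
  Finset.sum_range_succ _ _

/-- The Stolz region with vertex `ρ` and aperture `K`, in division-free form: for invertible
`ρ - |z|` it says that `K` bounds the quotient `|ρ - z| (ρ - |z|)⁻¹`. -/
def stolzRegion {A : Type*} [ConditionallyCompleteLattice A] [Ring A] [Algebra ℝ A] (ρ K : A) :
    Set (Cplx A) :=
  {z | z.modulus ≤ ρ ∧ (ofReal ρ - z).modulus ≤ K * (ρ - z.modulus)}

theorem ofReal_mem_stolzRegion {A : Type*} [ConditionallyCompleteLattice A] [Ring A] [Algebra ℝ A]
    [IsFAlgebra A] {ρ : A} (hρ : 0 ≤ ρ) (K : A) : ofReal ρ ∈ stolzRegion ρ K :=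
  ⟨(modulus_ofReal hρ).le, by simp [modulus_ofReal hρ, modulus_zero]⟩

theorem sum_range_succ_mul_pow_sub {R : Type*} [CommRing R] (f : ℕ → R) (r : R) (j : ℕ) :
    ∑ i ∈ Finset.range (j + 1), f i * r ^ (j - i) =
      r * ∑ i ∈ Finset.range j, f i * r ^ (j - 1 - i) + f j := by
  rw [Finset.sum_range_succ, Finset.mul_sum, Nat.sub_self, pow_zero, mul_one]
  congr 1
  refine Finset.sum_congr rfl fun i hi => ?_
  have hexp : j - i = j - 1 - i + 1 := by have := Finset.mem_range.1 hi; omega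
  rw [hexp, pow_succ]
  ring

-- Multiplying by `r ^ (N + j)` keeps Abel's summation by parts free of the quotient `z / r`.
theorem partialSum_sub_partialSum_mul_pow {A : Type*} [CommRing A] (a : ℕ → Cplx A)
    (r z s : Cplx A) (N j : ℕ) :
    (partialSum a z (N + j) - partialSum a z N) * r ^ (N + j) =
      (partialSum a r (N + j) - s) * z ^ (N + j) - (partialSum a r N - s) * z ^ N * r ^ j +
        (r - z) * ∑ i ∈ Finset.range j,
          (partialSum a r (N + i) - s) * z ^ (N + i) * r ^ (j - 1 - i) := by
  induction j with
  | zero => simp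
  | succ j ih =>
    rw [Nat.add_sub_cancel, sum_range_succ_mul_pow_sub, ← add_assoc, partialSum_succ,
      partialSum_succ]
    linear_combination r * ih

variable {A : Type*} [ConditionallyCompleteLattice A] [CommRing A] [Algebra ℝ A] [IsFAlgebra A]

theorem modulus_sub_mul_sum_le {r z : Cplx A} {ρ K b : A} (hr : r.modulus ≤ ρ)
    (hz : z.modulus ≤ ρ) (hK : 0 ≤ K) (hrz : (r - z).modulus ≤ K * (ρ - z.modulus))
    {D : ℕ → Cplx A} (hD : ∀ i, (D i).modulus ≤ b) (N j : ℕ) :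
    ((r - z) * ∑ i ∈ Finset.range j, D i * z ^ (N + i) * r ^ (j - 1 - i)).modulus ≤
      K * b * ρ ^ (N + j) := by
  have hz₀ := modulus_nonneg z
  have hb : 0 ≤ b := (modulus_nonneg _).trans (hD 0)
  have hρ : 0 ≤ ρ := hz₀.trans hz
  have hsum : (∑ i ∈ Finset.range j, D i * z ^ (N + i) * r ^ (j - 1 - i)).modulus ≤
      b * z.modulus ^ N * ∑ i ∈ Finset.range j, z.modulus ^ i * ρ ^ (j - 1 - i) := by
    refine (modulus_sum_le _ _).trans ?_
    rw [Finset.mul_sum]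
    refine Finset.sum_le_sum fun i _ => ?_
    calc (D i * z ^ (N + i) * r ^ (j - 1 - i)).modulus
        ≤ b * z.modulus ^ (N + i) * ρ ^ (j - 1 - i) :=
          modulus_mul_le_of_le (modulus_mul_le_of_le (hD i) (modulus_pow_le_of_le le_rfl _))
            (modulus_pow_le_of_le hr _)
      _ = b * z.modulus ^ N * (z.modulus ^ i * ρ ^ (j - 1 - i)) := by rw [pow_add]; ring
  calc _ ≤ K * (ρ - z.modulus) *
        (b * z.modulus ^ N * ∑ i ∈ Finset.range j, z.modulus ^ i * ρ ^ (j - 1 - i)) :=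
        modulus_mul_le_of_le hrz hsum
    _ = K * b * (z.modulus ^ N * (ρ ^ j - z.modulus ^ j)) := by
        linear_combination -(K * b * z.modulus ^ N) * geom_sum₂_mul z.modulus ρ j
    _ ≤ K * b * (ρ ^ N * ρ ^ j) :=
        mul_le_mul_of_nonneg_left
          (mul_le_mul (pow_le_pow_left₀ hz₀ hz N) (sub_le_self _ (pow_nonneg hz₀ j))
            (sub_nonneg.2 (pow_le_pow_left₀ hz₀ hz j)) (pow_nonneg hρ N)) (mul_nonneg hK hb)
    _ = K * b * ρ ^ (N + j) := by rw [pow_add]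

theorem modulus_partialSum_sub_partialSum_le {a : ℕ → Cplx A} {ρ K : A} {z s : Cplx A} {p : ℕ → A}
    (hρu : IsWeakOrderUnit ρ) (hp : Antitone p)
    (hs : ∀ n, (partialSum a (ofReal ρ) n - s).modulus ≤ p n) (hz : z.modulus ≤ ρ) (hK : 0 ≤ K)
    (hstolz : (ofReal ρ - z).modulus ≤ K * (ρ - z.modulus)) {N M : ℕ} (hNM : N ≤ M) :
    (partialSum a z M - partialSum a z N).modulus ≤ (2 + K) * p N := by
  obtain ⟨j, rfl⟩ := Nat.exists_eq_add_of_le hNM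
  have hr : (ofReal ρ).modulus ≤ ρ := (modulus_ofReal hρu.1).le
  have hD : ∀ i, (partialSum a (ofReal ρ) (N + i) - s).modulus ≤ p N := fun i =>
    (hs _).trans (hp (Nat.le_add_right N i))
  refine modulus_le_of_modulus_mul_ofReal_le (hρu.pow (N + j)) ?_
  rw [ofReal_pow, partialSum_sub_partialSum_mul_pow a (ofReal ρ) z s N j]
  calc _ ≤ p N * ρ ^ (N + j) + p N * ρ ^ N * ρ ^ j + K * p N * ρ ^ (N + j) :=
        (modulus_add_le _ _).trans (add_le_add
          ((modulus_sub_le _ _).trans (add_le_add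
            (modulus_mul_le_of_le (hD j) (modulus_pow_le_of_le hz _))
            (modulus_mul_le_of_le (modulus_mul_le_of_le (hD 0) (modulus_pow_le_of_le hz N))
              (modulus_pow_le_of_le hr j))))
          (modulus_sub_mul_sum_le hr hz hK hstolz hD N j))
    _ = (2 + K) * p N * ρ ^ (N + j) := by rw [pow_add]; ring

theorem modulus_pow_sub_pow_le {w c : Cplx A} {ρ : A} (hw : w.modulus ≤ ρ) (hc : c.modulus ≤ ρ)
    (n : ℕ) : (w ^ n - c ^ n).modulus ≤ n * ρ ^ (n - 1) * (w - c).modulus := by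
  rw [← geom_sum₂_mul, ← geom_sum₂_self]
  refine modulus_mul_le_of_le ((modulus_sum_le _ _).trans (Finset.sum_le_sum fun i _ => ?_)) le_rfl
  exact modulus_mul_le_of_le (modulus_pow_le_of_le hw i) (modulus_pow_le_of_le hc _)

theorem modulus_partialSum_sub_le_mul (a : ℕ → Cplx A) {w c : Cplx A} {ρ : A}
    (hw : w.modulus ≤ ρ) (hc : c.modulus ≤ ρ) (m : ℕ) :
    (partialSum a w m - partialSum a c m).modulus ≤
      (∑ n ∈ Finset.range (m + 1), (a n).modulus * (n * ρ ^ (n - 1))) * (w - c).modulus := by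
  rw [partialSum, partialSum, ← Finset.sum_sub_distrib, Finset.sum_mul]
  refine (modulus_sum_le _ _).trans (Finset.sum_le_sum fun n _ => ?_)
  rw [← mul_sub, mul_assoc]
  exact modulus_mul_le_of_le le_rfl (modulus_pow_sub_pow_le hw hc n)

theorem orderTendsto_of_forall_modulus_partialSum_sub_le {a : ℕ → Cplx A} {D : Set (Cplx A)}
    {S : Cplx A → Cplx A} {p : ℕ → A} (hp : DecreasesToZero p)
    (hS : ∀ m, ∀ w ∈ D, (partialSum a w m - S w).modulus ≤ p m) {ρ : A}
    (hD : ∀ w ∈ D, w.modulus ≤ ρ) {c : Cplx A} (hc : c ∈ D) {z : ℕ → Cplx A} (hzD : ∀ k, z k ∈ D)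
    (hz : OrderTendsto z c) : OrderTendsto (fun k => S (z k)) (S c) := by
  obtain ⟨q, hq, hz⟩ := hz
  have hρ : 0 ≤ ρ := (modulus_nonneg c).trans (hD c hc)
  set Q : ℕ → A := fun m => ∑ n ∈ Finset.range (m + 1), (a n).modulus * (n * ρ ^ (n - 1))
  have hQ₀ : ∀ m, 0 ≤ Q m := fun m => Finset.sum_nonneg fun n _ =>
    mul_nonneg (modulus_nonneg _) (mul_nonneg n.cast_nonneg (pow_nonneg hρ _))
  refine ⟨_, decreasesToZero_iInf_add_mul (hp.add hp) hq hQ₀, fun k => le_ciInf fun m => ?_⟩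
  calc (S (z k) - S c).modulus
      ≤ (S (z k) - partialSum a (z k) m).modulus +
          ((partialSum a (z k) m - partialSum a c m).modulus +
            (partialSum a c m - S c).modulus) :=
        (modulus_sub_le_add _ _ _).trans (add_le_add_right (modulus_sub_le_add _ _ _) _)
    _ ≤ p m + (Q m * q k + p m) :=
        add_le_add ((modulus_sub_comm _ _).trans_le (hS m _ (hzD k)))
          (add_le_add ((modulus_partialSum_sub_le_mul a (hD _ (hzD k)) (hD c hc) m).trans
            (mul_le_mul_of_nonneg_left (hz k) (hQ₀ m))) (hS m c hc))
    _ = p m + p m + Q m * q k := by ring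

theorem convergesUniformlyInOrderOn_stolzRegion {a : ℕ → Cplx A} {ρ : A} {s : Cplx A}
    (hρu : IsWeakOrderUnit ρ) (hs : HasOrderSum a (ofReal ρ) s) (K : A) :
    ConvergesUniformlyInOrderOn a (stolzRegion ρ K) := by
  obtain ⟨p, hp, hs⟩ := hs
  have hq : DecreasesToZero fun n => (2 + K⁺) * p n :=
    hp.mul_left (add_nonneg zero_le_two (posPart_nonneg K))
  have hlim : ∀ z ∈ stolzRegion ρ K, ∃ l, ∀ m, (partialSum a z m - l).modulus ≤ (2 + K⁺) * p m := by
    rintro z ⟨hz, hstolz⟩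
    have hstolz' : (ofReal ρ - z).modulus ≤ K⁺ * (ρ - z.modulus) :=
      hstolz.trans (mul_le_mul_of_nonneg_right (le_posPart K) (sub_nonneg.2 hz))
    exact hq.exists_forall_modulus_sub_le fun N M hNM =>
      modulus_partialSum_sub_partialSum_le hρu hp.1 hs hz (posPart_nonneg K) hstolz' hNM
  choose! S hS using hlim
  exact ⟨S, _, hq, fun m z hz => hS z hz m⟩

end PowerSeries

end VLSeries

theorem mainTheorem6_general {A : Type*} [ConditionallyCompleteLattice A] [Ring A] [Algebra ℝ A]
    [IsFAlgebra A] (a : ℕ → Cplx A) (ρ K : A) (hρu : IsWeakOrderUnit ρ)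
    (s : Cplx A) (hs : HasOrderSum a (Cplx.ofReal ρ) s)
    (z : ℕ → Cplx A) (hz : OrderTendsto z (Cplx.ofReal ρ)) (hzK : ∀ k, z k ∈ stolzRegion ρ K) :
    ∃ σ : ℕ → Cplx A, (∀ k, HasOrderSum a (z k) (σ k)) ∧ OrderTendsto σ s := by
  let _ : CommRing A := { ‹Ring A› with mul_comm := IsFAlgebra.mul_comm }
  obtain ⟨S, p, hp, hS⟩ := convergesUniformlyInOrderOn_stolzRegion hρu hs K
  have hρK : Cplx.ofReal ρ ∈ stolzRegion ρ K := ofReal_mem_stolzRegion hρu.1 K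
  have hsum : ∀ w ∈ stolzRegion ρ K, HasOrderSum a w (S w) := fun w hw =>
    ⟨p, hp, fun m => hS m w hw⟩
  refine ⟨fun k => S (z k), fun k => hsum (z k) (hzK k), ?_⟩
  rw [hs.unique (hsum _ hρK)]
  exact orderTendsto_of_forall_modulus_partialSum_sub_le hp hS (fun w hw => hw.1) hρK hzK hz

/-- Here `Cplx A` is a universally complete complex vector lattice with real part `A`.  The
assumption `|z k| ≪ ρ` makes `ρ - |z k|` invertible, so that `Ring.inverse` is its inverse. -/
theorem mainTheorem6 {A : Type*} [ConditionallyCompleteLattice A] [Ring A] [Algebra ℝ A]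
    [IsFAlgebra A] [IsLaterallyComplete A]
    (a : ℕ → Cplx A) (ρ : A) (hρ : HasRadiusOfConvergence a ρ) (hρu : IsWeakOrderUnit ρ)
    (s : Cplx A) (hs : HasOrderSum a (Cplx.ofReal ρ) s)
    (z : ℕ → Cplx A) (hz : OrderTendsto z (Cplx.ofReal ρ))
    (hlt : ∀ k, MuchLess (z k).modulus ρ)
    (hbdd : IsOrderBounded (Set.range fun k =>
      (Cplx.ofReal ρ - z k).modulus * Ring.inverse (ρ - (z k).modulus))) :
    ∃ σ : ℕ → Cplx A, (∀ k, HasOrderSum a (z k) (σ k)) ∧ OrderTendsto σ s := by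
  let _ : CommRing A := { ‹Ring A› with mul_comm := IsFAlgebra.mul_comm }
  obtain ⟨K, hK⟩ := exists_forall_le_mul_of_isOrderBounded_mul_inverse
    (fun k => (hlt k).isWeakOrderUnit_sub) hbdd
  exact mainTheorem6_general a ρ K hρu s hs z hz fun k => ⟨(hlt k).le, hK k⟩
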